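/- Let $k\ge 1$ be a fixed integer. Let $d_k(n)$ be the number of ordered $k$-tuples of positive integers with product $n$, and let $$a_k=\prod_{p}\Bigl(1-\frac1p\Bigr)^{k^2}\sum_{j=0}^{\infty}\frac{d_k(p^j)^2}{p^j},$$ the product being over all primes $p$. Let $\gamma_k=\mathrm{vol}(\mathcal P_k)$ be the Lebesgue volume of the polytope of substochastic matrices $$\mathcal P_k=\Bigl\{(x_{ij})_{1\le i,j\le k}\in\mathbb R^{k^2} : x_{ij}\ge 0,\ \sum_{i=1}^k x_{ij}\le 1 \text{ for every } j,\ \sum_{j=1}^k x_{ij}\le 1\text{ for every } i\Bigr\}.$$ Then the series and the product defining $a_k$ converge (absolutely), for every real $X$ the limit below exists, and, as $X\to\infty$, $$\lim_{T\to\infty}\frac1T\int_0^T\Bigl|\sum_{1\le n\le X}\frac{1}{n^{\frac12+it}}\Bigr|^{2k}\,dt=a_k\,\gamma_k\,(\log X)^{k^2}+O\bigl((\log X)^{k^2-1}\bigr),$$ where the implied constant depends only on $k$. -/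

import Mathlib

open Filter Topology MeasureTheory Asymptotics

noncomputable section

namespace Pseudomoments

/-- The `k`-fold divisor function `d_k(n)`: the number of ordered `k`-tuples of
positive integers with product `n`. -/
def divisorFun (k n : ℕ) : ℕ := (Nat.finMulAntidiag k n).card

/-- The `j`-th term `d_k(p^j)² / p^j` of the local series at `p`. -/
def localTerm (k p j : ℕ) : ℝ := (divisorFun k (p ^ j) : ℝ) ^ 2 / (p : ℝ) ^ j

/-- The local factor `(1 - 1/p)^(k²) ∑_{j ≥ 0} d_k(p^j)² / p^j`. -/
def localFactor (k p : ℕ) : ℝ := (1 - 1 / (p : ℝ)) ^ (k ^ 2) * ∑' j : ℕ, localTerm k p j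

/-- The arithmetic factor `a_k`, the product of the local factors over all primes. -/
def arithmeticFactor (k : ℕ) : ℝ := ∏' p : Nat.Primes, localFactor k p

/-- The polytope of substochastic `k × k` matrices, inside `ℝ^(k²)`. -/
def substochasticPolytope (k : ℕ) : Set (Fin k → Fin k → ℝ) :=
  {x | (∀ i j, 0 ≤ x i j) ∧ (∀ j, ∑ i, x i j ≤ 1) ∧ (∀ i, ∑ j, x i j ≤ 1)}

/-- The geometric factor `γ_k`: the Lebesgue volume of the polytope (which lies in the
unit cube, so this volume is finite). -/
def geometricFactor (k : ℕ) : ℝ := (volume (substochasticPolytope k)).toReal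

/-- The partial sum `∑_{1 ≤ n ≤ X} n^(-(1/2 + it))`. -/
def partialZeta (X t : ℝ) : ℂ :=
  ∑ n ∈ Finset.Icc 1 ⌊X⌋₊, 1 / (n : ℂ) ^ ((1 / 2 : ℂ) + Complex.I * (t : ℂ))

end Pseudomoments

end

/-!
Expanding the `2k`-th power and averaging over `t` keeps only the diagonal: the mean value is the
sum of `1 / (m₁ ⋯ m_k)` over `m, n ∈ [1, X]^k` with `m₁ ⋯ m_k = n₁ ⋯ n_k` (`pseudomoment`).

Such pairs `(m, n)` are parametrized by `k × k` arrays `x` of positive integers with row products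
`m` and column products `n`. An array with given margins is not unique, but it becomes so if for
each prime `p` the cells with `p ∣ x v` are required to form a chain in the product order: this is
the northwest corner rule of transportation theory, applied to the exponents of each prime
(`exists_isStaircaseArray_margins`, `IsStaircaseArray.eq_of_margins_eq`). Hence the mean value is a
sum of `1 / ∏ x` over arrays with all row and column products at most `X`, restricted by a condition
that is local at each prime (`pseudomoment_eq_sum_arrays`).

Without the local condition, and with `x` confined to the multiples of an array `e`, the sum is a
volume: replacing an entry `n` by the interval between the harmonic numbers `H_{n-1}` and `H_n`,
which has length `1 / n` and lies near `log n`, turns the arrays into disjoint boxes that fill the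
polytope of substochastic matrices dilated by `log X`, up to a bounded change of the dilation factor
and a shift by `log e`. This gives `γ_k (log X)^(k²)` with relative error
`O((1 + ∑ log e) / log X)` (`exists_multiplesSum_bound`).

The local condition is removed by inclusion-exclusion over sets of incomparable pairs of cells, one
set for each prime `p ≤ X` (`pseudomoment_expansion`). The main terms multiply to the product over
`p ≤ X` of `localWeight k (1 / p)`, which is the local factor of `a_k` at `p` because the
northwest corner rule also counts the pairs behind `d_k(p^j)²` (`localFactor_eq`). Since an
incomparable pair involves two cells, every nontrivial term at `p` is `O(p⁻²)`; and since
`1 + ∑ log e` is at most a product over primes, the total error is bounded by a convergent product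
(`exists_pseudomoment_bound`). Finally, the product over `p ≤ X` is replaced by the whole Euler
product at the cost of `O(1 / log X)` (`abs_tprod_sub_prod_le`).
-/

namespace Pseudomoments

/-! ### The mean value as a sum over multiplicative coincidences -/

/-- The diagonal contribution to the `2k`-th moment: the sum of `1 / (m₁ ⋯ m_k)` over all
`m, n ∈ [1, N]^k` with `m₁ ⋯ m_k = n₁ ⋯ n_k`. -/
noncomputable def pseudomoment (k N : ℕ) : ℝ :=
  ∑ m ∈ Fintype.piFinset (fun _ : Fin k => Finset.Icc 1 N),
    ∑ n ∈ Fintype.piFinset (fun _ : Fin k => Finset.Icc 1 N),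
      if ∏ i, m i = ∏ i, n i then 1 / ((∏ i, m i : ℕ) : ℝ) else 0

lemma tendsto_mean_cos (θ : ℝ) :
    Tendsto (fun T : ℝ => (1 / T) * ∫ t in (0 : ℝ)..T, Real.cos (t * θ)) atTop
      (𝓝 (if θ = 0 then 1 else 0)) := by
  split_ifs with h
  · subst h
    refine tendsto_const_nhds.congr' ?_
    filter_upwards [eventually_gt_atTop 0] with T hT
    simp [hT.ne']
  · have hint : ∀ T : ℝ, ∫ t in (0 : ℝ)..T, Real.cos (t * θ) = θ⁻¹ * Real.sin (T * θ) := by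
      intro T
      rw [intervalIntegral.integral_comp_mul_right _ h]
      simp
    simp_rw [hint]
    have h1 : Tendsto (fun T : ℝ => 1 / T) atTop (𝓝 0) := by
      simpa using tendsto_inv_atTop_zero (𝕜 := ℝ)
    refine h1.zero_mul_isBoundedUnder_le ⟨|θ⁻¹|, ?_⟩
    simp only [eventually_map]
    refine Eventually.of_forall fun T => ?_
    simp only [Function.comp, norm_mul, Real.norm_eq_abs]
    exact mul_le_of_le_one_right (abs_nonneg _) (Real.abs_sin_le_one _)

lemma one_div_natCast_cpow {n : ℕ} (hn : n ≠ 0) (s : ℂ) :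
    1 / (n : ℂ) ^ s = Complex.exp (-(Real.log n : ℂ) * s) := by
  have h0 : (n : ℂ) ≠ 0 := Nat.cast_ne_zero.mpr hn
  rw [Complex.cpow_def_of_ne_zero h0, Complex.natCast_log, neg_mul, Complex.exp_neg, one_div]

lemma partialZeta_pow (k : ℕ) (X t : ℝ) :
    partialZeta X t ^ k = ∑ m ∈ Fintype.piFinset (fun _ : Fin k => Finset.Icc 1 ⌊X⌋₊),
      Complex.exp (-(Real.log (∏ i, m i : ℕ) : ℂ) * ((1 / 2 : ℂ) + Complex.I * (t : ℂ))) := by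
  rw [partialZeta, Finset.sum_pow']
  refine Finset.sum_congr rfl fun m hm => ?_
  rw [Fintype.mem_piFinset] at hm
  have hpos : ∀ i, m i ≠ 0 := fun i => by
    have := Finset.mem_Icc.1 (hm i)
    omega
  rw [Finset.prod_congr rfl fun i _ => one_div_natCast_cpow (hpos i) _, ← Complex.exp_sum,
    ← Finset.sum_mul, Nat.cast_prod, Real.log_prod fun i _ => Nat.cast_ne_zero.mpr (hpos i)]
  simp

lemma norm_partialZeta_pow (k : ℕ) (X t : ℝ) :
    ‖partialZeta X t‖ ^ (2 * k) =
      ∑ m ∈ Fintype.piFinset (fun _ : Fin k => Finset.Icc 1 ⌊X⌋₊),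
        ∑ n ∈ Fintype.piFinset (fun _ : Fin k => Finset.Icc 1 ⌊X⌋₊),
          Real.exp (-(Real.log (∏ i, m i : ℕ) + Real.log (∏ i, n i : ℕ)) / 2) *
            Real.cos (t * (Real.log (∏ i, n i : ℕ) - Real.log (∏ i, m i : ℕ))) := by
  have h : ‖partialZeta X t‖ ^ (2 * k) =
      (partialZeta X t ^ k * (starRingEnd ℂ) (partialZeta X t ^ k)).re := by
    rw [Complex.mul_conj, Complex.ofReal_re, Complex.normSq_eq_norm_sq, norm_pow, ← pow_mul,
      mul_comm]
  rw [h, partialZeta_pow, map_sum, Finset.sum_mul_sum, Complex.re_sum]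
  refine Finset.sum_congr rfl fun m _ => ?_
  rw [Complex.re_sum]
  refine Finset.sum_congr rfl fun n _ => ?_
  generalize Real.log (∏ i, m i : ℕ) = a
  generalize Real.log (∏ i, n i : ℕ) = b
  rw [← Complex.exp_conj, ← Complex.exp_add, Complex.exp_re]
  congr 2
  · simp
    ring
  · simp
    ring

lemma tendsto_mean_partialZeta (k : ℕ) (X : ℝ) :
    Tendsto (fun T : ℝ => (1 / T) * ∫ t in (0 : ℝ)..T, ‖partialZeta X t‖ ^ (2 * k)) atTop
      (𝓝 (pseudomoment k ⌊X⌋₊)) := by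
  have hcont : ∀ c θ : ℝ, Continuous fun t : ℝ => c * Real.cos (t * θ) := by
    intro c θ; fun_prop
  have hint : ∀ T : ℝ, (1 / T) * ∫ t in (0 : ℝ)..T, ‖partialZeta X t‖ ^ (2 * k) =
      ∑ m ∈ Fintype.piFinset (fun _ : Fin k => Finset.Icc 1 ⌊X⌋₊),
        ∑ n ∈ Fintype.piFinset (fun _ : Fin k => Finset.Icc 1 ⌊X⌋₊),
          Real.exp (-(Real.log (∏ i, m i : ℕ) + Real.log (∏ i, n i : ℕ)) / 2) *
            ((1 / T) * ∫ t in (0 : ℝ)..T,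
              Real.cos (t * (Real.log (∏ i, n i : ℕ) - Real.log (∏ i, m i : ℕ)))) := by
    intro T
    simp_rw [norm_partialZeta_pow]
    rw [intervalIntegral.integral_finsetSum fun m _ =>
      (continuous_finsetSum _ fun n _ => hcont _ _).intervalIntegrable _ _, Finset.mul_sum]
    refine Finset.sum_congr rfl fun m _ => ?_
    rw [intervalIntegral.integral_finsetSum fun n _ => (hcont _ _).intervalIntegrable _ _,
      Finset.mul_sum]
    refine Finset.sum_congr rfl fun n _ => ?_
    rw [intervalIntegral.integral_const_mul]
    ring
  simp_rw [hint, pseudomoment]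
  refine tendsto_finsetSum _ fun m hm => tendsto_finsetSum _ fun n hn => ?_
  have hpos : ∀ l ∈ Fintype.piFinset (fun _ : Fin k => Finset.Icc 1 ⌊X⌋₊),
      0 < ((∏ i, l i : ℕ) : ℝ) := by
    intro l hl
    rw [Fintype.mem_piFinset] at hl
    exact Nat.cast_pos.mpr (Finset.prod_pos fun i _ => (Finset.mem_Icc.1 (hl i)).1)
  have hm' := hpos m hm
  have hn' := hpos n hn
  convert (tendsto_mean_cos (Real.log (∏ i, n i : ℕ) - Real.log (∏ i, m i : ℕ))).const_mul
    (Real.exp (-(Real.log (∏ i, m i : ℕ) + Real.log (∏ i, n i : ℕ)) / 2)) using 2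
  have hiff : Real.log (∏ i, n i : ℕ) - Real.log (∏ i, m i : ℕ) = 0 ↔
      ∏ i, m i = ∏ i, n i := by
    rw [sub_eq_zero, Real.log_injOn_pos.eq_iff hn' hm', Nat.cast_inj, eq_comm]
  by_cases h : ∏ i, m i = ∏ i, n i
  · rw [if_pos h, if_pos (hiff.2 h), ← h, mul_one, ← two_mul, ← mul_neg,
      mul_div_cancel_left₀ _ (two_ne_zero), Real.exp_neg, Real.exp_log hm', one_div]
  · rw [if_neg h, if_neg (mt hiff.1 h), mul_zero]

/-! ### Arrays with staircase support and prescribed margins -/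

/-- A set of cells of the `k × k` grid, given as a predicate, is a staircase if it contains no two
cells one of which lies strictly below and strictly to the left of the other; equivalently it is a
chain for the product order. -/
def IsStaircase {k : ℕ} (P : Fin k × Fin k → Prop) : Prop :=
  ∀ i i' j j', i < i' → j' < j → ¬(P (i, j) ∧ P (i', j'))

/-- One half of the uniqueness argument: at a first difference `(i, j)` the array `y` cannot exceed
`z`, for otherwise `z` would have to compensate both further right in row `i` and further down
in column `j`. -/
lemma IsStaircase.le_of_first_difference {k : ℕ} {y z : Fin k × Fin k → ℕ}
    (hz : IsStaircase fun v => 0 < z v)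
    (hrow : ∀ i, ∑ j, y (i, j) = ∑ j, z (i, j)) (hcol : ∀ j, ∑ i, y (i, j) = ∑ i, z (i, j))
    (i j : Fin k) (hi : ∀ i' < i, y (i', j) = z (i', j)) (hj : ∀ j' < j, y (i, j') = z (i, j')) :
    y (i, j) ≤ z (i, j) := by
  by_contra! hlt
  have h1 : ∃ j', j < j' ∧ 0 < z (i, j') := by
    by_contra! hno
    refine absurd (hrow i) (ne_of_gt (Finset.sum_lt_sum (fun j' _ => ?_) ⟨j, by simp, hlt⟩))
    rcases lt_trichotomy j' j with h | h | h
    · exact (hj j' h).ge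
    · exact h ▸ hlt.le
    · exact (hno j' h).trans (Nat.zero_le _)
  have h2 : ∃ i', i < i' ∧ 0 < z (i', j) := by
    by_contra! hno
    refine absurd (hcol j) (ne_of_gt (Finset.sum_lt_sum (fun i' _ => ?_) ⟨i, by simp, hlt⟩))
    rcases lt_trichotomy i' i with h | h | h
    · exact (hi i' h).ge
    · exact h ▸ hlt.le
    · exact (hno i' h).trans (Nat.zero_le _)
  obtain ⟨j', hj', hzj⟩ := h1
  obtain ⟨i', hi', hzi⟩ := h2
  exact hz i i' j' j hi' hj' ⟨hzj, hzi⟩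

lemma IsStaircase.eq_of_margins_eq {k : ℕ} {y z : Fin k × Fin k → ℕ}
    (hy : IsStaircase fun v => 0 < y v) (hz : IsStaircase fun v => 0 < z v)
    (hrow : ∀ i, ∑ j, y (i, j) = ∑ j, z (i, j)) (hcol : ∀ j, ∑ i, y (i, j) = ∑ i, z (i, j)) :
    y = z := by
  have key : ∀ i j, y (i, j) = z (i, j) := by
    intro i
    induction i using WellFoundedLT.induction with
    | ind i ihi =>
      intro j
      induction j using WellFoundedLT.induction with
      | ind j ihj =>
        exact le_antisymm
          (hz.le_of_first_difference hrow hcol i j (fun i' h => ihi i' h j) ihj)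
          (hy.le_of_first_difference (fun i => (hrow i).symm) (fun j => (hcol j).symm) i j
            (fun i' h => (ihi i' h j).symm) fun j' h => (ihj j' h).symm)
  exact funext fun v => key v.1 v.2

/-- The intervals between consecutive values of `B` cut `[a, a')` into pieces of total length
`a' - a`; truncated subtraction makes the disjoint intervals contribute `0`. -/
lemma sum_overlap {k : ℕ} {B : ℕ → ℕ} (hB : Monotone B) (hB0 : B 0 = 0) {a a' : ℕ}
    (haa : a ≤ a') (ha' : a' ≤ B k) :
    ∑ j : Fin k, (min a' (B (j + 1)) - max a (B j)) = a' - a := by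
  have hmono : Monotone fun n => min (max (B n) a) a' := fun m n h => by
    have := hB h
    simp only
    omega
  have h := Finset.sum_range_tsub hmono k
  rw [Fin.sum_univ_eq_sum_range (fun j => min a' (B (j + 1)) - max a (B j)) k]
  rw [show a' - a = min (max (B k) a) a' - min (max (B 0) a) a' by omega, ← h]
  refine Finset.sum_congr rfl fun j _ => ?_
  have := hB (Nat.le_succ j)
  simp only [Nat.succ_eq_add_one] at this
  omega

/-- The northwest corner rule. Cut `[0, n)`, where `n` is the common total, into consecutive
intervals of lengths `a i` and into consecutive intervals of lengths `b j`; the entry at `(i, j)`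
is the length of the overlap of the `i`-th interval of the first kind with the `j`-th of the
second. -/
lemma exists_isStaircase_margins {k : ℕ} (a b : Fin k → ℕ) (hab : ∑ i, a i = ∑ j, b j) :
    ∃ y : Fin k × Fin k → ℕ, (IsStaircase fun v => 0 < y v) ∧
      (∀ i, ∑ j, y (i, j) = a i) ∧ (∀ j, ∑ i, y (i, j) = b j) := by
  let ext (c : Fin k → ℕ) (n : ℕ) : ℕ := if h : n < k then c ⟨n, h⟩ else 0
  let cum (c : Fin k → ℕ) (n : ℕ) : ℕ := ∑ i ∈ Finset.range n, ext c i
  have hext : ∀ (c : Fin k → ℕ) (i : Fin k), ext c i = c i := fun c i => by simp [ext]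
  have hsucc : ∀ (c : Fin k → ℕ) (i : Fin k), cum c (i + 1) = cum c i + c i := fun c i => by
    simp only [cum, Finset.sum_range_succ, hext]
  have hmono : ∀ c, Monotone (cum c) := fun c m n h =>
    Finset.sum_le_sum_of_subset (Finset.range_mono h)
  have hzero : ∀ c, cum c 0 = 0 := fun c => by simp [cum]
  have htot : ∀ c, cum c k = ∑ i, c i := fun c => by
    simp only [cum]
    rw [← Fin.sum_univ_eq_sum_range (ext c) k]
    exact Finset.sum_congr rfl fun i _ => hext c i
  refine ⟨fun v => min (cum a (v.1 + 1)) (cum b (v.2 + 1)) - max (cum a v.1) (cum b v.2),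
    ?_, ?_, ?_⟩
  · intro i i' j j' hi hj ⟨h1, h2⟩
    have h3 := hmono a (show (i : ℕ) + 1 ≤ i' from hi)
    have h4 := hmono b (show (j' : ℕ) + 1 ≤ j from hj)
    simp only at h1 h2
    omega
  · intro i
    have h := hmono a (show (i : ℕ) + 1 ≤ k from i.2)
    rw [htot, hab, ← htot] at h
    simp only
    rw [sum_overlap (hmono b) (hzero b) (hmono a (Nat.le_succ i)) h, Nat.succ_eq_add_one, hsucc]
    omega
  · intro j
    have h := hmono b (show (j : ℕ) + 1 ≤ k from j.2)
    rw [htot, ← hab, ← htot] at h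
    have h' := sum_overlap (hmono a) (hzero a) (hmono b (Nat.le_succ j)) h
    rw [Nat.succ_eq_add_one] at h'
    simp only [min_comm _ (cum b (j + 1)), max_comm _ (cum b j)]
    rw [h', hsucc]
    omega

/-- An array of integers is a staircase array if for every prime `p` its entries divisible by `p`
form a staircase. -/
def IsStaircaseArray {k : ℕ} (x : Fin k × Fin k → ℕ) : Prop :=
  ∀ p : ℕ, p.Prime → IsStaircase fun v => p ∣ x v

lemma IsStaircaseArray.factorization {k : ℕ} {x : Fin k × Fin k → ℕ} (hx : IsStaircaseArray x)
    {p : ℕ} (hp : p.Prime) : IsStaircase fun v => 0 < (x v).factorization p :=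
  fun i i' j j' hi hj h => hx p hp i i' j j' hi hj
    ⟨Nat.dvd_of_factorization_pos h.1.ne', Nat.dvd_of_factorization_pos h.2.ne'⟩

lemma factorization_prod_apply {ι : Type*} [Fintype ι] {x : ι → ℕ} (hx : ∀ i, x i ≠ 0) (p : ℕ) :
    (∏ i, x i).factorization p = ∑ i, (x i).factorization p := by
  rw [Nat.factorization_prod fun i _ => hx i, Finsupp.finsetSum_apply]

lemma IsStaircaseArray.eq_of_margins_eq {k : ℕ} {x x' : Fin k × Fin k → ℕ}
    (hx : IsStaircaseArray x) (hx' : IsStaircaseArray x') (h0 : ∀ v, x v ≠ 0)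
    (h0' : ∀ v, x' v ≠ 0) (hrow : ∀ i, ∏ j, x (i, j) = ∏ j, x' (i, j))
    (hcol : ∀ j, ∏ i, x (i, j) = ∏ i, x' (i, j)) : x = x' := by
  refine funext fun v => Nat.eq_of_factorization_eq (h0 v) (h0' v) fun p => ?_
  by_cases hp : p.Prime
  · have h := IsStaircase.eq_of_margins_eq (hx.factorization hp) (hx'.factorization hp)
      (fun i => by
        rw [← factorization_prod_apply (fun j => h0 (i, j)),
          ← factorization_prod_apply (fun j => h0' (i, j)), hrow i])
      (fun j => by
        rw [← factorization_prod_apply (fun i => h0 (i, j)),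
          ← factorization_prod_apply (fun i => h0' (i, j)), hcol j])
    exact congrFun h v
  · simp [Nat.factorization_eq_zero_of_not_prime _ hp]

lemma exists_isStaircaseArray_margins {k : ℕ} (m n : Fin k → ℕ) (hm : ∀ i, m i ≠ 0)
    (hn : ∀ j, n j ≠ 0) (hmn : ∏ i, m i = ∏ j, n j) :
    ∃ x : Fin k × Fin k → ℕ, IsStaircaseArray x ∧ (∀ v, x v ≠ 0) ∧
      (∀ i, ∏ j, x (i, j) = m i) ∧ (∀ j, ∏ i, x (i, j) = n j) := by
  have hex : ∀ p : ℕ, ∃ y : Fin k × Fin k → ℕ, (IsStaircase fun v => 0 < y v) ∧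
      (∀ i, ∑ j, y (i, j) = (m i).factorization p) ∧
      (∀ j, ∑ i, y (i, j) = (n j).factorization p) := fun p =>
    exists_isStaircase_margins _ _ (by
      rw [← factorization_prod_apply hm, ← factorization_prod_apply hn, hmn])
  choose y hy hyrow hycol using hex
  have hsupp : ∀ v p, y p v ≠ 0 → p ∈ (m v.1).primeFactors := fun v p h => by
    rw [← Nat.support_factorization, Finsupp.mem_support_iff, ← hyrow p v.1]
    exact fun h0 => h (Finset.sum_eq_zero_iff.1 h0 v.2 (Finset.mem_univ _))
  let f (v : Fin k × Fin k) : ℕ →₀ ℕ := Finsupp.onFinset _ (fun p => y p v) (hsupp v)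
  have hprime : ∀ v, ∀ p ∈ (f v).support, p.Prime := fun v p hp =>
    Nat.prime_of_mem_primeFactors (hsupp v p (Finsupp.mem_support_iff.1 hp))
  have hfac : ∀ v p, ((f v).prod (· ^ ·)).factorization p = y p v := fun v p => by
    rw [Nat.prod_pow_factorization_eq_self (hprime v)]
    rfl
  have hne : ∀ v, (f v).prod (· ^ ·) ≠ 0 := fun v =>
    Finset.prod_ne_zero_iff.2 fun p hp => pow_ne_zero _ (hprime v p hp).ne_zero
  refine ⟨fun v => (f v).prod (· ^ ·), ?_, hne, fun i => ?_, fun j => ?_⟩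
  · intro p hp i i' j j' hi hj ⟨h1, h2⟩
    refine hy p i i' j j' hi hj ⟨?_, ?_⟩
    · beta_reduce
      rw [← hfac]
      exact hp.factorization_pos_of_dvd (hne _) h1
    · beta_reduce
      rw [← hfac]
      exact hp.factorization_pos_of_dvd (hne _) h2
  · refine Nat.eq_of_factorization_eq (Finset.prod_ne_zero_iff.2 fun j _ => hne _) (hm i) fun p => ?_
    rw [factorization_prod_apply fun j => hne (i, j), ← hyrow p i]
    exact Finset.sum_congr rfl fun j _ => hfac _ _
  · refine Nat.eq_of_factorization_eq (Finset.prod_ne_zero_iff.2 fun i _ => hne _) (hn j) fun p => ?_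
    rw [factorization_prod_apply fun i => hne (i, j), ← hycol p j]
    exact Finset.sum_congr rfl fun i _ => hfac _ _

/-- The arrays of positive integers all of whose row and column products are at most `N`. The bound
`N` on the entries is implied by the one on the products; it makes the set visibly finite. -/
def boundedArrays (k N : ℕ) : Finset (Fin k × Fin k → ℕ) :=
  {x ∈ Fintype.piFinset fun _ => Finset.Icc 1 N |
    (∀ i, ∏ j, x (i, j) ≤ N) ∧ ∀ j, ∏ i, x (i, j) ≤ N}

lemma mem_boundedArrays {k N : ℕ} {x : Fin k × Fin k → ℕ} :
    x ∈ boundedArrays k N ↔ (∀ v, x v ≠ 0) ∧ (∀ i, ∏ j, x (i, j) ≤ N) ∧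
      ∀ j, ∏ i, x (i, j) ≤ N := by
  simp only [boundedArrays, Finset.mem_filter, Fintype.mem_piFinset, Finset.mem_Icc]
  refine and_congr_left fun h => ⟨fun h' v => by have := h' v; omega, fun h' v =>
    ⟨Nat.one_le_iff_ne_zero.2 (h' v), le_trans ?_ (h.1 v.1)⟩⟩
  exact Finset.single_le_prod' (f := fun j => x (v.1, j))
    (fun j _ => Nat.one_le_iff_ne_zero.2 (h' _)) (Finset.mem_univ v.2)

open Classical in
/-- Taking row and column products identifies staircase arrays with the pairs of `k`-tuples
having equal products. -/
lemma pseudomoment_eq_sum_arrays (k N : ℕ) :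
    pseudomoment k N = ∑ x ∈ boundedArrays k N,
      if IsStaircaseArray x then 1 / ((∏ v, x v : ℕ) : ℝ) else 0 := by
  rw [pseudomoment, ← Finset.sum_product', ← Finset.sum_filter, ← Finset.sum_filter]
  symm
  refine Finset.sum_bij (fun x _ => (fun i => ∏ j, x (i, j), fun j => ∏ i, x (i, j))) ?_ ?_ ?_ ?_
  · intro x hx
    simp only [Finset.mem_filter, mem_boundedArrays, Finset.mem_product, Fintype.mem_piFinset,
      Finset.mem_Icc] at hx ⊢
    have hpos : ∀ v, 0 < x v := fun v => Nat.pos_of_ne_zero (hx.1.1 v)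
    exact ⟨⟨fun i => ⟨Finset.prod_pos fun _ _ => hpos _, hx.1.2.1 i⟩,
      fun i => ⟨Finset.prod_pos fun _ _ => hpos _, hx.1.2.2 i⟩⟩, Finset.prod_comm⟩
  · intro x hx x' hx' h
    simp only [Finset.mem_filter, mem_boundedArrays] at hx hx'
    rw [Prod.mk.injEq] at h
    exact hx.2.eq_of_margins_eq hx'.2 hx.1.1 hx'.1.1 (congrFun h.1) (congrFun h.2)
  · rintro ⟨m, n⟩ hmn
    simp only [Finset.mem_filter, Finset.mem_product, Fintype.mem_piFinset,
      Finset.mem_Icc] at hmn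
    obtain ⟨⟨hm, hn⟩, heq⟩ := hmn
    obtain ⟨x, hx, h0, hr, hc⟩ := exists_isStaircaseArray_margins m n
      (fun i => Nat.one_le_iff_ne_zero.1 (hm i).1) (fun i => Nat.one_le_iff_ne_zero.1 (hn i).1) heq
    refine ⟨x, ?_, by simp only [hr, hc]⟩
    simp only [Finset.mem_filter, mem_boundedArrays, hr, hc]
    exact ⟨⟨h0, fun i => (hm i).2, fun i => (hn i).2⟩, hx⟩
  · intro x hx
    rw [Fintype.prod_prod_type]

/-! ### Harmonic cells and the volume of the polytope -/

lemma harmonic_real_mono : Monotone fun n : ℕ => (harmonic n : ℝ) :=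
  monotone_nat_of_le_succ fun n => by
    rw [harmonic_succ]
    push_cast
    have : (0 : ℝ) ≤ ((n : ℝ) + 1)⁻¹ := by positivity
    linarith

/-- The `n`-th cell (`n ≥ 1`) of the partition of `[0, ∞)` by the harmonic numbers. It has
length `1 / n` and lies within distance `1` of `log n`. -/
def harmonicCell (n : ℕ) : Set ℝ := Set.Ico (harmonic (n - 1) : ℝ) (harmonic n : ℝ)

lemma volume_harmonicCell {n : ℕ} (hn : n ≠ 0) :
    volume (harmonicCell n) = ENNReal.ofReal (1 / (n : ℝ)) := by
  obtain ⟨m, rfl⟩ := Nat.exists_eq_succ_of_ne_zero hn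
  rw [harmonicCell, Real.volume_Ico, Nat.succ_sub_one, Nat.succ_eq_add_one, harmonic_succ]
  congr 1
  push_cast
  ring

lemma harmonicCell_inj {m n : ℕ} {u : ℝ} (hm : u ∈ harmonicCell m) (hn : u ∈ harmonicCell n) :
    m = n := by
  by_contra hne
  rcases Nat.lt_or_gt_of_ne hne with h | h
  · have := harmonic_real_mono (show m ≤ n - 1 by omega)
    exact absurd (hm.2.trans_le (this.trans hn.1)) (lt_irrefl _)
  · have := harmonic_real_mono (show n ≤ m - 1 by omega)
    exact absurd (hn.2.trans_le (this.trans hm.1)) (lt_irrefl _)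

lemma log_le_of_mem_harmonicCell {n : ℕ} (hn : n ≠ 0) {u : ℝ} (hu : u ∈ harmonicCell n) :
    Real.log n ≤ u := by
  obtain ⟨m, rfl⟩ := Nat.exists_eq_succ_of_ne_zero hn
  exact (log_add_one_le_harmonic m).trans hu.1

lemma le_one_add_log_of_mem_harmonicCell {n : ℕ} {u : ℝ} (hu : u ∈ harmonicCell n) :
    u ≤ 1 + Real.log n :=
  hu.2.le.trans (harmonic_le_one_add_log n)

lemma exists_mem_harmonicCell {u : ℝ} (hu : 0 ≤ u) : ∃ n : ℕ, n ≠ 0 ∧ u ∈ harmonicCell n := by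
  have hex : ∃ n : ℕ, u < harmonic n := by
    obtain ⟨n, hn⟩ := exists_nat_gt (Real.exp u)
    refine ⟨n, ?_⟩
    have h1 : u < Real.log n := (Real.lt_log_iff_exp_lt ((Real.exp_pos u).trans hn)).2 hn
    refine h1.trans_le (le_trans (Real.log_le_log ((Real.exp_pos u).trans hn) ?_)
      (log_add_one_le_harmonic n))
    exact_mod_cast Nat.le_succ n
  classical
  have h0 : Nat.find hex ≠ 0 := fun h => by
    have := Nat.find_spec hex
    rw [h, harmonic_zero, Rat.cast_zero] at this
    exact absurd this (not_lt.2 hu)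
  refine ⟨Nat.find hex, h0, not_lt.1 (Nat.find_min hex (by omega)), Nat.find_spec hex⟩

/-- The box in `ℝ^(k²)` whose sides are the harmonic cells of the entries of `x`. -/
def arrayCell {k : ℕ} (x : Fin k × Fin k → ℕ) : Set (Fin k → Fin k → ℝ) :=
  Set.univ.pi fun i => Set.univ.pi fun j => harmonicCell (x (i, j))

lemma mem_arrayCell {k : ℕ} {x : Fin k × Fin k → ℕ} {u : Fin k → Fin k → ℝ} :
    u ∈ arrayCell x ↔ ∀ i j, u i j ∈ harmonicCell (x (i, j)) := by
  simp [arrayCell]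

lemma measurableSet_arrayCell {k : ℕ} (x : Fin k × Fin k → ℕ) : MeasurableSet (arrayCell x) :=
  MeasurableSet.univ_pi fun _ => MeasurableSet.univ_pi fun _ => measurableSet_Ico

lemma volume_arrayCell {k : ℕ} {x : Fin k × Fin k → ℕ} (hx : ∀ v, x v ≠ 0) :
    volume (arrayCell x) = ENNReal.ofReal (∏ v, 1 / (x v : ℝ)) := by
  rw [arrayCell, volume_pi_pi, Fintype.prod_prod_type,
    ENNReal.ofReal_prod_of_nonneg fun _ _ => Finset.prod_nonneg fun _ _ => by positivity]
  refine Finset.prod_congr rfl fun i _ => ?_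
  rw [volume_pi_pi, ENNReal.ofReal_prod_of_nonneg fun _ _ => by positivity]
  exact Finset.prod_congr rfl fun j _ => volume_harmonicCell (hx _)

/-- The dilate by `R` of the polytope of substochastic matrices. -/
def dilatedPolytope (k : ℕ) (R : ℝ) : Set (Fin k → Fin k → ℝ) :=
  {x | (∀ i j, 0 ≤ x i j) ∧ (∀ j, ∑ i, x i j ≤ R) ∧ (∀ i, ∑ j, x i j ≤ R)}

open Pointwise in
lemma dilatedPolytope_eq_smul (k : ℕ) {R : ℝ} (hR : 0 < R) :
    dilatedPolytope k R = R • substochasticPolytope k := by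
  ext x
  rw [Set.mem_smul_set_iff_inv_smul_mem₀ hR.ne']
  simp only [dilatedPolytope, substochasticPolytope, Set.mem_ofPred_eq, Pi.smul_apply, smul_eq_mul,
    ← Finset.mul_sum, inv_mul_le_one₀ hR]
  simp [hR]

lemma volume_dilatedPolytope (k : ℕ) {R : ℝ} (hR : 0 < R) :
    volume (dilatedPolytope k R) =
      ENNReal.ofReal (R ^ (k ^ 2)) * volume (substochasticPolytope k) := by
  rw [dilatedPolytope_eq_smul k hR, Measure.addHaar_smul, abs_of_pos (by positivity),
    Module.finrank_pi_fintype]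
  simp [sq]

lemma volume_substochasticPolytope_ne_top (k : ℕ) : volume (substochasticPolytope k) ≠ ⊤ := by
  refine ((measure_mono ?_).trans_lt
    (isCompact_Icc (a := (0 : Fin k → Fin k → ℝ)) (b := 1)).measure_lt_top).ne
  rintro x ⟨h0, -, hr⟩
  exact ⟨fun i j => h0 i j, fun i j =>
    (Finset.single_le_sum (f := fun j => x i j) (fun j _ => h0 i j) (Finset.mem_univ j)).trans
      (hr i)⟩

lemma geometricFactor_nonneg (k : ℕ) : 0 ≤ geometricFactor k := ENNReal.toReal_nonneg

lemma volume_dilatedPolytope_eq_ofReal (k : ℕ) {R : ℝ} (hR : 0 < R) :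
    volume (dilatedPolytope k R) = ENNReal.ofReal (geometricFactor k * R ^ (k ^ 2)) := by
  rw [volume_dilatedPolytope k hR, geometricFactor, mul_comm (ENNReal.toReal _),
    ENNReal.ofReal_mul (by positivity), ENNReal.ofReal_toReal
      (volume_substochasticPolytope_ne_top k)]

/-! ### Reciprocal sums over arrays in a progression -/

/-- The sum of `∏ e / ∏ x` over the bounded arrays `x` that are entrywise multiples of `e`. -/
noncomputable def multiplesSum (k N : ℕ) (e : Fin k × Fin k → ℕ) : ℝ :=
  ∑ x ∈ boundedArrays k N with ∀ v, e v ∣ x v, ∏ v, 1 / ((x v / e v : ℕ) : ℝ)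

lemma multiplesSum_nonneg (k N : ℕ) (e : Fin k × Fin k → ℕ) : 0 ≤ multiplesSum k N e :=
  Finset.sum_nonneg fun _ _ => Finset.prod_nonneg fun _ _ => by positivity

/-- The sum is the volume of a disjoint union of boxes, one for each quotient array. -/
lemma ofReal_multiplesSum (k N : ℕ) {e : Fin k × Fin k → ℕ} (he : ∀ v, e v ≠ 0) :
    ENNReal.ofReal (multiplesSum k N e) =
      volume (⋃ x ∈ {x ∈ boundedArrays k N | ∀ v, e v ∣ x v}, arrayCell fun v => x v / e v) := by
  rw [measure_biUnion_finset, multiplesSum, ENNReal.ofReal_sum_of_nonneg]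
  · refine Finset.sum_congr rfl fun x hx => ?_
    simp only [Finset.mem_filter, mem_boundedArrays] at hx
    exact (volume_arrayCell fun v =>
      (Nat.div_pos (Nat.le_of_dvd (Nat.pos_of_ne_zero (hx.1.1 v)) (hx.2 v))
        (Nat.pos_of_ne_zero (he v))).ne').symm
  · exact fun _ _ => Finset.prod_nonneg fun _ _ => by positivity
  · intro x hx x' hx' hne
    simp only [Finset.coe_filter, Set.mem_ofPred_eq] at hx hx'
    refine Set.disjoint_left.2 fun u hu hu' => hne (funext fun v => ?_)
    have h := harmonicCell_inj (mem_arrayCell.1 hu v.1 v.2) (mem_arrayCell.1 hu' v.1 v.2)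
    rw [← Nat.mul_div_cancel' (hx.2 v), ← Nat.mul_div_cancel' (hx'.2 v)]
    exact congrArg _ h
  · exact fun x _ => measurableSet_arrayCell _

lemma sum_log_le_iff {ι : Type*} [Fintype ι] {x : ι → ℕ} (hx : ∀ i, x i ≠ 0) {X : ℝ}
    (hX : 0 < X) : ∏ i, x i ≤ ⌊X⌋₊ ↔ ∑ i, Real.log (x i) ≤ Real.log X := by
  have hpos : (0 : ℝ) < ∏ i, (x i : ℝ) :=
    Finset.prod_pos fun i _ => Nat.cast_pos.2 (Nat.pos_of_ne_zero (hx i))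
  rw [Nat.le_floor_iff hX.le, Nat.cast_prod,
    ← Real.log_prod fun i _ => Nat.cast_ne_zero.2 (hx i), Real.log_le_log_iff hpos hX]

lemma multiplesSum_le (k : ℕ) {X : ℝ} (hX : 1 ≤ Real.log X) (hX0 : 0 < X)
    {e : Fin k × Fin k → ℕ} (he : ∀ v, e v ≠ 0) :
    multiplesSum k ⌊X⌋₊ e ≤ geometricFactor k * (Real.log X + k) ^ (k ^ 2) := by
  have hR : 0 < Real.log X + k := by positivity
  have hγ := geometricFactor_nonneg k
  rw [← ENNReal.ofReal_le_ofReal_iff (by positivity), ofReal_multiplesSum k _ he,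
    ← volume_dilatedPolytope_eq_ofReal k hR]
  refine measure_mono (Set.iUnion₂_subset fun x hx u hu => ?_)
  simp only [Finset.mem_filter, mem_boundedArrays] at hx
  obtain ⟨⟨h0, hr, hc⟩, hdvd⟩ := hx
  rw [mem_arrayCell] at hu
  have hle : ∀ i j, u i j ≤ 1 + Real.log (x (i, j)) := fun i j => by
    refine (le_one_add_log_of_mem_harmonicCell (hu i j)).trans ?_
    have hq : 0 < x (i, j) / e (i, j) :=
      Nat.div_pos (Nat.le_of_dvd (Nat.pos_of_ne_zero (h0 _)) (hdvd _))
        (Nat.pos_of_ne_zero (he _))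
    have := Real.log_le_log (Nat.cast_pos.2 hq) (Nat.cast_le.2 (Nat.div_le_self (x (i, j)) _))
    linarith
  refine ⟨fun i j => le_trans ?_ (hu i j).1, fun j => ?_, fun i => ?_⟩
  · have := harmonic_real_mono (Nat.zero_le (x (i, j) / e (i, j) - 1))
    simpa using this
  · calc ∑ i, u i j ≤ ∑ i, (1 + Real.log (x (i, j))) := Finset.sum_le_sum fun i _ => hle i j
      _ = k + ∑ i, Real.log (x (i, j)) := by simp [Finset.sum_add_distrib]
      _ ≤ Real.log X + k := by
        have := (sum_log_le_iff (fun i => h0 (i, j)) hX0).1 (hc j)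
        linarith
  · calc ∑ j, u i j ≤ ∑ j, (1 + Real.log (x (i, j))) := Finset.sum_le_sum fun j _ => hle i j
      _ = k + ∑ j, Real.log (x (i, j)) := by simp [Finset.sum_add_distrib]
      _ ≤ Real.log X + k := by
        have := (sum_log_le_iff (fun j => h0 (i, j)) hX0).1 (hr i)
        linarith

lemma le_multiplesSum (k : ℕ) {X : ℝ} (hX0 : 0 < X) {e : Fin k × Fin k → ℕ} (he : ∀ v, e v ≠ 0)
    (hR : 0 < Real.log X - ∑ v, Real.log (e v)) :
    geometricFactor k * (Real.log X - ∑ v, Real.log (e v)) ^ (k ^ 2) ≤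
      multiplesSum k ⌊X⌋₊ e := by
  rw [← ENNReal.ofReal_le_ofReal_iff (multiplesSum_nonneg _ _ _), ofReal_multiplesSum k _ he,
    ← volume_dilatedPolytope_eq_ofReal k hR]
  refine measure_mono fun u hu => ?_
  obtain ⟨hu0, huc, hur⟩ := hu
  choose n hn0 hn using fun v : Fin k × Fin k => exists_mem_harmonicCell (hu0 v.1 v.2)
  have hne : ∀ v, e v * n v ≠ 0 := fun v => mul_ne_zero (he v) (hn0 v)
  have hlog : ∀ v : Fin k × Fin k,
      Real.log ((e v * n v : ℕ) : ℝ) ≤ Real.log (e v) + u v.1 v.2 := fun v => by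
    rw [Nat.cast_mul, Real.log_mul (Nat.cast_ne_zero.2 (he v)) (Nat.cast_ne_zero.2 (hn0 v))]
    have := log_le_of_mem_harmonicCell (hn0 v) (hn v)
    linarith
  have hloge : ∀ v, 0 ≤ Real.log (e v) := fun v => Real.log_natCast_nonneg _
  refine Set.mem_iUnion₂.2 ⟨fun v => e v * n v, ?_, mem_arrayCell.2 fun i j => ?_⟩
  · simp only [Finset.mem_filter, mem_boundedArrays, dvd_mul_right, implies_true, and_true]
    refine ⟨hne, fun i => (sum_log_le_iff (fun j => hne (i, j)) hX0).2 ?_,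
      fun j => (sum_log_le_iff (fun i => hne (i, j)) hX0).2 ?_⟩
    · have h1 : ∑ j, Real.log (e (i, j)) ≤ ∑ v, Real.log (e v) := by
        rw [Fintype.sum_prod_type]
        exact Finset.single_le_sum (f := fun i => ∑ j, Real.log (e (i, j)))
          (fun i _ => Finset.sum_nonneg fun j _ => hloge (i, j)) (Finset.mem_univ i)
      calc ∑ j, Real.log ((e (i, j) * n (i, j) : ℕ) : ℝ)
          ≤ ∑ j, (Real.log (e (i, j)) + u i j) := Finset.sum_le_sum fun j _ => hlog (i, j)
        _ = ∑ j, Real.log (e (i, j)) + ∑ j, u i j := Finset.sum_add_distrib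
        _ ≤ Real.log X := by linarith [hur i]
    · have h1 : ∑ i, Real.log (e (i, j)) ≤ ∑ v, Real.log (e v) := by
        rw [Fintype.sum_prod_type_right]
        exact Finset.single_le_sum (f := fun j => ∑ i, Real.log (e (i, j)))
          (fun j _ => Finset.sum_nonneg fun i _ => hloge (i, j)) (Finset.mem_univ j)
      calc ∑ i, Real.log ((e (i, j) * n (i, j) : ℕ) : ℝ)
          ≤ ∑ i, (Real.log (e (i, j)) + u i j) := Finset.sum_le_sum fun i _ => hlog (i, j)
        _ = ∑ i, Real.log (e (i, j)) + ∑ i, u i j := Finset.sum_add_distrib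
        _ ≤ Real.log X := by linarith [huc j]
  · simp only [Nat.mul_div_cancel_left _ (Nat.pos_of_ne_zero (he (i, j)))]
    exact hn (i, j)

/-- The number of arrays in a progression, weighted by reciprocals, is asymptotic to the volume of
the dilated polytope; the dependence of the error on the modulus `e` is only logarithmic. -/
lemma exists_multiplesSum_bound (k : ℕ) : ∃ K : ℝ, 0 ≤ K ∧ ∀ X : ℝ, 0 < X → 1 ≤ Real.log X →
    ∀ e : Fin k × Fin k → ℕ, (∀ v, e v ≠ 0) →
      |multiplesSum k ⌊X⌋₊ e - geometricFactor k * Real.log X ^ (k ^ 2)| ≤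
        K * (1 + ∑ v, Real.log (e v)) * Real.log X ^ (k ^ 2 - 1) := by
  have hγ := geometricFactor_nonneg k
  set γ := geometricFactor k with hγdef
  set n := k ^ 2 with hn
  refine ⟨γ * (n * (k + 1) * (1 + k) ^ (n - 1)), by positivity, fun X hX0 hX e he => ?_⟩
  set L := Real.log X with hL
  set D := ∑ v, Real.log (e v) with hD
  have hD0 : 0 ≤ D := Finset.sum_nonneg fun v _ => Real.log_natCast_nonneg _
  have hL0 : 0 < L := by linarith
  -- The constant dominates the ones needed for the upper bound and for the lower bound.
  have hC1 : γ * (k * n * (1 + k) ^ (n - 1)) ≤ γ * (n * (k + 1) * (1 + k) ^ (n - 1)) * (1 + D) := by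
    have h : γ * (k * n * (1 + k) ^ (n - 1)) ≤ γ * (n * (k + 1) * (1 + k) ^ (n - 1)) := by
      have : (k * n : ℝ) ≤ n * (k + 1) := by nlinarith [(Nat.cast_nonneg n : (0 : ℝ) ≤ n)]
      gcongr
    refine h.trans (le_mul_of_one_le_right (by positivity) (by linarith))
  have hC2 : γ * (n * D) ≤ γ * (n * (k + 1) * (1 + k) ^ (n - 1)) * (1 + D) := by
    have h1 : (1 : ℝ) ≤ (k + 1) * (1 + k) ^ (n - 1) := by
      have h2 : (1 : ℝ) ≤ (1 + (k : ℝ)) ^ (n - 1) := one_le_pow₀ (by linarith [k.cast_nonneg (α := ℝ)])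
      nlinarith [k.cast_nonneg (α := ℝ)]
    calc γ * (n * D) ≤ γ * (n * 1) * (1 + D) := by
          have : 0 ≤ γ * n := by positivity
          nlinarith
      _ ≤ γ * (n * ((k + 1) * (1 + k) ^ (n - 1))) * (1 + D) := by gcongr
      _ = _ := by ring
  rw [abs_le]
  constructor
  · have hlow : γ * L ^ n - γ * (n * D) * L ^ (n - 1) ≤ multiplesSum k ⌊X⌋₊ e := by
      rcases lt_or_ge 0 (L - D) with hR | hR
      · refine le_trans ?_ (le_multiplesSum k hX0 he hR)
        have h := (le_abs_self _).trans (abs_pow_sub_pow_le L (L - D) n)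
        rw [show L - (L - D) = D by ring, abs_of_nonneg hD0, abs_of_pos hL0, abs_of_pos hR,
          max_eq_left (by linarith)] at h
        have := mul_le_mul_of_nonneg_left h hγ
        rw [← hγdef, ← hL, ← hD, ← hn]
        nlinarith
      · -- Here `L ≤ D`: the sum may be empty, but the main term is itself within the error.
        refine le_trans ?_ (multiplesSum_nonneg _ _ _)
        rcases Nat.eq_zero_or_pos n with h0 | h0
        · have hk : k = 0 := by simpa [hn] using h0
          subst hk
          simp only [hD, Finset.univ_eq_empty, Finset.sum_empty, sub_zero] at hR
          exact absurd hR (not_le.2 hL0)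
        · have h1 : L ^ n = L * L ^ (n - 1) := (mul_pow_sub_one h0.ne' L).symm
          have h2 : L ≤ n * D := by
            have : (1 : ℝ) ≤ n := by exact_mod_cast h0
            nlinarith
          have h3 : γ * L ^ (n - 1) * L ≤ γ * L ^ (n - 1) * (n * D) := by gcongr
          rw [h1]
          linarith
    have := mul_le_mul_of_nonneg_right hC2 (pow_nonneg hL0.le (n - 1))
    linarith
  · have hup := multiplesSum_le k hX hX0 he
    rw [← hγdef, ← hL, ← hn] at hup
    have h := (le_abs_self _).trans (abs_pow_sub_pow_le (L + k) L n)
    rw [show L + k - L = (k : ℝ) by ring, abs_of_nonneg (Nat.cast_nonneg k : (0 : ℝ) ≤ k),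
      abs_of_pos hL0, abs_of_pos (by positivity : 0 < L + k),
      max_eq_left (by linarith [k.cast_nonneg (α := ℝ)])] at h
    have h1 : (L + k) ^ (n - 1) ≤ (1 + k) ^ (n - 1) * L ^ (n - 1) := by
      rw [← mul_pow]
      gcongr
      nlinarith [k.cast_nonneg (α := ℝ)]
    have h2 : (L + k) ^ n - L ^ n ≤ k * n * ((1 + k) ^ (n - 1) * L ^ (n - 1)) :=
      h.trans (by gcongr)
    have h3 := mul_le_mul_of_nonneg_left h2 hγ
    have := mul_le_mul_of_nonneg_right hC1 (pow_nonneg hL0.le (n - 1))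
    linarith

/-! ### Expanding the staircase condition over antichains -/

/-- The pairs of cells of the `k × k` grid that are incomparable in the product order. -/
def incomparablePairs (k : ℕ) : Finset ((Fin k × Fin k) × (Fin k × Fin k)) :=
  {q | q.1.1 < q.2.1 ∧ q.2.2 < q.1.2}

/-- The set of cells occurring in a set of pairs of cells. -/
def cover {k : ℕ} (S : Finset ((Fin k × Fin k) × (Fin k × Fin k))) : Finset (Fin k × Fin k) :=
  S.image Prod.fst ∪ S.image Prod.snd

lemma forall_mem_cover {k : ℕ} {S : Finset ((Fin k × Fin k) × (Fin k × Fin k))}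
    {P : Fin k × Fin k → Prop} : (∀ v ∈ cover S, P v) ↔ ∀ q ∈ S, P q.1 ∧ P q.2 := by
  simp only [cover, Finset.forall_mem_union, Finset.forall_mem_image]
  exact ⟨fun h q hq => ⟨h.1 hq, h.2 hq⟩, fun h => ⟨fun q hq => (h q hq).1,
    fun q hq => (h q hq).2⟩⟩

lemma isStaircase_iff {k : ℕ} {P : Fin k × Fin k → Prop} :
    IsStaircase P ↔ ∀ q ∈ incomparablePairs k, ¬(P q.1 ∧ P q.2) := by
  constructor
  · intro h q hq
    simp only [incomparablePairs, Finset.mem_filter, Finset.mem_univ, true_and] at hq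
    exact h q.1.1 q.2.1 q.1.2 q.2.2 hq.1 hq.2
  · intro h i i' j j' hi hj
    exact h ((i, j), (i', j')) (by simp [incomparablePairs, hi, hj])

lemma two_le_card_cover {k : ℕ} {S : Finset ((Fin k × Fin k) × (Fin k × Fin k))}
    (hS : S ⊆ incomparablePairs k) (hne : S ≠ ∅) : 2 ≤ (cover S).card := by
  obtain ⟨q, hq⟩ := Finset.nonempty_iff_ne_empty.2 hne
  have hq' := hS hq
  simp only [incomparablePairs, Finset.mem_filter, Finset.mem_univ, true_and] at hq'
  refine Finset.one_lt_card.2 ⟨q.1, ?_, q.2, ?_, fun h => hq'.1.ne (congrArg Prod.fst h)⟩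
  · exact Finset.mem_union_left _ (Finset.mem_image_of_mem _ hq)
  · exact Finset.mem_union_right _ (Finset.mem_image_of_mem _ hq)

lemma card_cover_le {k : ℕ} (S : Finset ((Fin k × Fin k) × (Fin k × Fin k))) :
    (cover S).card ≤ k ^ 2 :=
  (Finset.card_le_univ _).trans_eq (by simp [sq])

open Classical in
/-- Inclusion-exclusion over the incomparable pairs. -/
lemma staircase_indicator {k : ℕ} (P : Fin k × Fin k → Prop) :
    (if IsStaircase P then (1 : ℝ) else 0) = ∑ S ∈ (incomparablePairs k).powerset,
      (-1) ^ S.card * if ∀ v ∈ cover S, P v then (1 : ℝ) else 0 := by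
  have h1 : (if IsStaircase P then (1 : ℝ) else 0) =
      ∏ q ∈ incomparablePairs k, (1 - if P q.1 ∧ P q.2 then (1 : ℝ) else 0) := by
    have h2 : ∀ q : (Fin k × Fin k) × (Fin k × Fin k),
        (1 - if P q.1 ∧ P q.2 then (1 : ℝ) else 0) = if ¬(P q.1 ∧ P q.2) then 1 else 0 := by
      intro q
      split_ifs <;> simp
    rw [Finset.prod_congr rfl fun q _ => h2 q, Finset.prod_ite_zero, Finset.prod_const_one]
    simp only [isStaircase_iff]
    congr
  rw [h1, Finset.prod_sub]
  refine Finset.sum_congr rfl fun S _ => ?_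
  rw [Finset.prod_ite_zero, Finset.prod_const_one, Finset.prod_const_one, mul_one]
  simp only [forall_mem_cover]
  congr

/-! ### The local factors -/

/-- The probability that the set of cells chosen independently with probability `t` each is a
staircase, written as an inclusion-exclusion sum. At `t = 1 / p` it is the local factor at `p`. -/
noncomputable def localWeight (k : ℕ) (t : ℝ) : ℝ :=
  ∑ S ∈ (incomparablePairs k).powerset, (-1) ^ S.card * t ^ (cover S).card

lemma hasSum_fin_prod (n : ℕ) (g : Fin n → ℕ → ℝ) (hg : ∀ v m, 0 ≤ g v m) (s : Fin n → ℝ)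
    (hs : ∀ v, HasSum (g v) (s v)) :
    HasSum (fun y : Fin n → ℕ => ∏ v, g v (y v)) (∏ v, s v) := by
  induction n with
  | zero =>
    have h : (fun y : Fin 0 → ℕ => ∏ v, g v (y v)) = fun _ => 1 := by simp
    rw [h, Fin.prod_univ_zero]
    exact hasSum_unique fun _ : Fin 0 → ℕ => (1 : ℝ)
  | succ n ih =>
    have h := ih (fun a => g a.succ) (fun a => hg a.succ) (fun a => s a.succ)
      fun a => hs a.succ
    have hnn : ∀ y : Fin n → ℕ, 0 ≤ ∏ a, g a.succ (y a) := fun y =>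
      Finset.prod_nonneg fun a _ => hg _ _
    have hsum : Summable fun x : ℕ × (Fin n → ℕ) => g 0 x.1 * ∏ a, g (Fin.succ a) (x.2 a) :=
      Summable.mul_of_nonneg (f := g 0) (g := fun y : Fin n → ℕ => ∏ a, g (Fin.succ a) (y a))
        (hs 0).summable h.summable (hg 0) hnn
    have hmul := HasSum.mul (f := g 0) (g := fun y : Fin n → ℕ => ∏ a, g (Fin.succ a) (y a))
      (hs 0) h hsum
    rw [← (Fin.consEquiv fun _ => ℕ).hasSum_iff, Fin.prod_univ_succ]
    have heq : (fun y : Fin (n + 1) → ℕ => ∏ v, g v (y v)) ∘ (Fin.consEquiv fun _ => ℕ) =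
        fun x : ℕ × (Fin n → ℕ) => g 0 x.1 * ∏ a, g (Fin.succ a) (x.2 a) := by
      funext x
      simp [Fin.prod_univ_succ, Fin.consEquiv]
    rw [heq]
    exact hmul

lemma hasSum_pi_prod {V : Type*} [Fintype V] {g : V → ℕ → ℝ} (hg : ∀ v n, 0 ≤ g v n)
    {s : V → ℝ} (hs : ∀ v, HasSum (g v) (s v)) :
    HasSum (fun y : V → ℕ => ∏ v, g v (y v)) (∏ v, s v) := by
  let e := (Fintype.equivFin V).symm
  have h := hasSum_fin_prod _ (fun a => g (e a)) (fun a => hg (e a)) (fun a => s (e a))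
    fun a => hs (e a)
  rw [e.prod_comp s] at h
  rw [← (Equiv.arrowCongr e (Equiv.refl ℕ)).hasSum_iff]
  convert! h using 2 with y
  simp only [Function.comp]
  rw [← e.prod_comp]
  simp

/-- The generating function of arrays with staircase support, by total. -/
lemma hasSum_staircase (k : ℕ) {t : ℝ} (ht0 : 0 ≤ t) (ht1 : t < 1) [DecidablePred
    fun y : Fin k × Fin k → ℕ => IsStaircase fun v => 0 < y v] :
    HasSum (fun y : Fin k × Fin k → ℕ =>
      if IsStaircase (fun v => 0 < y v) then t ^ (∑ v, y v) else 0)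
      (localWeight k t * ((1 - t)⁻¹) ^ (k ^ 2)) := by
  classical
  have hcell : ∀ (S : Finset ((Fin k × Fin k) × (Fin k × Fin k))) (v : Fin k × Fin k),
      HasSum (fun n : ℕ => if v ∈ cover S → 0 < n then t ^ n else 0)
        ((if v ∈ cover S then t else 1) * (1 - t)⁻¹) := by
    intro S v
    have hgeo := hasSum_geometric_of_lt_one ht0 ht1
    by_cases hv : v ∈ cover S
    · simp only [hv, true_imp_iff, if_true]
      rw [← hasSum_nat_add_iff' 1]
      simpa [pow_succ', Nat.pos_iff_ne_zero] using hgeo.mul_left t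
    · simpa [hv] using hgeo
  have hS := fun S : Finset ((Fin k × Fin k) × (Fin k × Fin k)) =>
    hasSum_pi_prod (g := fun v n => if v ∈ cover S → 0 < n then t ^ n else 0)
      (fun v n => by split_ifs <;> positivity) (hcell S)
  have hsum := hasSum_sum fun S (_ : S ∈ (incomparablePairs k).powerset) =>
    (hS S).mul_left ((-1 : ℝ) ^ S.card)
  convert! hsum using 1
  · funext y
    have h := congrArg (· * t ^ (∑ v, y v)) (staircase_indicator fun v => 0 < y v)
    simp only [ite_mul, one_mul, zero_mul, Finset.sum_mul] at h
    convert! h using 1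
    refine Finset.sum_congr rfl fun S _ => ?_
    rw [Fintype.prod_ite_zero, Finset.prod_pow_eq_pow_sum]
    split_ifs <;> simp
  · rw [localWeight, Finset.sum_mul]
    refine Finset.sum_congr rfl fun S _ => ?_
    rw [Finset.prod_mul_distrib, Finset.prod_const, Finset.prod_ite_mem, Finset.univ_inter,
      Finset.prod_const, Finset.card_univ, Fintype.card_prod, Fintype.card_fin, ← sq, mul_assoc]

lemma divisorFun_prime_pow (k : ℕ) {p : ℕ} (hp : p.Prime) (j : ℕ) :
    divisorFun k (p ^ j) = (Finset.piAntidiag (Finset.univ : Finset (Fin k)) j).card := by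
  rw [divisorFun]
  symm
  refine Finset.card_bij (fun a _ i => p ^ a i) ?_ ?_ ?_
  · intro a ha
    rw [Finset.mem_piAntidiag] at ha
    rw [Nat.mem_finMulAntidiag, Finset.prod_pow_eq_pow_sum, ha.1]
    exact ⟨rfl, pow_ne_zero _ hp.ne_zero⟩
  · intro a _ b _ h
    exact funext fun i => Nat.pow_right_injective hp.two_le (congrFun h i)
  · intro f hf
    have hdvd := fun i => (Nat.dvd_prime_pow hp).1 (Nat.dvd_of_mem_finMulAntidiag hf i)
    choose a _ ha using hdvd
    refine ⟨a, ?_, funext fun i => (ha i).symm⟩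
    rw [Finset.mem_piAntidiag]
    refine ⟨Nat.pow_right_injective hp.two_le ?_, fun i _ => Finset.mem_univ i⟩
    simp only
    rw [← Finset.prod_pow_eq_pow_sum, ← Nat.prod_eq_of_mem_finMulAntidiag hf]
    exact Finset.prod_congr rfl fun i _ => (ha i).symm

/-- The northwest corner rule again: pairs of vectors of total `j` correspond to arrays of total `j`
with staircase support. -/
lemma card_staircase (k j : ℕ) [DecidablePred
    fun y : Fin k × Fin k → ℕ => IsStaircase fun v => 0 < y v] :
    (Finset.piAntidiag (Finset.univ : Finset (Fin k)) j).card ^ 2 =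
      {y ∈ Finset.piAntidiag (Finset.univ : Finset (Fin k × Fin k)) j |
        IsStaircase fun v => 0 < y v}.card := by
  rw [sq, ← Finset.card_product]
  symm
  refine Finset.card_bij (fun y _ => (fun i => ∑ j, y (i, j), fun j => ∑ i, y (i, j))) ?_ ?_ ?_
  · intro y hy
    simp only [Finset.mem_filter, Finset.mem_piAntidiag, Finset.mem_univ, implies_true,
      and_true, Finset.mem_product] at hy ⊢
    exact ⟨by rw [← hy.1, Fintype.sum_prod_type], by rw [← hy.1, Fintype.sum_prod_type_right]⟩
  · intro y hy z hz h
    rw [Prod.mk.injEq] at h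
    exact (Finset.mem_filter.1 hy).2.eq_of_margins_eq (Finset.mem_filter.1 hz).2
      (congrFun h.1) (congrFun h.2)
  · rintro ⟨a, b⟩ hab
    simp only [Finset.mem_piAntidiag, Finset.mem_univ, implies_true, and_true,
      Finset.mem_product] at hab
    obtain ⟨y, hy, hr, hc⟩ := exists_isStaircase_margins a b (hab.1.trans hab.2.symm)
    refine ⟨y, ?_, by simp only [hr, hc]⟩
    simp only [Finset.mem_filter, Finset.mem_piAntidiag, Finset.mem_univ, implies_true, and_true]
    exact ⟨by rw [Fintype.sum_prod_type, ← hab.1]; simp only [hr], hy⟩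

lemma hasSum_localTerm (k : ℕ) {p : ℕ} (hp : p.Prime) :
    HasSum (localTerm k p)
      (localWeight k (1 / (p : ℝ)) * ((1 - 1 / (p : ℝ))⁻¹) ^ (k ^ 2)) := by
  classical
  have hp1 : (1 : ℝ) < p := by exact_mod_cast hp.one_lt
  have h := (hasSum_staircase k (t := 1 / (p : ℝ)) (by positivity)
    (by rw [div_lt_one (by linarith)]; exact hp1)).tsum_fiberwise fun y => ∑ v, y v
  convert! h using 1
  funext j
  have hset : (fun y : Fin k × Fin k → ℕ => ∑ v, y v) ⁻¹' {j} =
      ↑(Finset.piAntidiag (Finset.univ : Finset (Fin k × Fin k)) j) := by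
    ext y
    simp
  rw [hset, Finset.tsum_subtype' _ fun y : Fin k × Fin k → ℕ =>
    if IsStaircase (fun v => 0 < y v) then (1 / (p : ℝ)) ^ (∑ v, y v) else 0,
    ← Finset.sum_filter, Finset.sum_congr rfl (g := fun _ => (1 / (p : ℝ)) ^ j), Finset.sum_const,
    ← card_staircase, localTerm, divisorFun_prime_pow k hp]
  · simp [div_eq_mul_inv]
  · intro y hy
    simp only [Finset.mem_filter, Finset.mem_piAntidiag] at hy
    rw [hy.1.1]

lemma localFactor_eq (k : ℕ) {p : ℕ} (hp : p.Prime) :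
    localFactor k p = localWeight k (1 / (p : ℝ)) := by
  have hp1 : (1 : ℝ) < p := by exact_mod_cast hp.one_lt
  have hne : (1 - 1 / (p : ℝ)) ≠ 0 := by
    have : 1 / (p : ℝ) < 1 := by rw [div_lt_one (by linarith)]; exact hp1
    linarith
  rw [localFactor, (hasSum_localTerm k hp).tsum_eq, mul_comm, mul_assoc, ← mul_pow,
    inv_mul_cancel₀ hne, one_pow, mul_one]

/-- Apart from the empty set, every set of incomparable pairs involves at least two cells, so its
weight is `O(t²)`. -/
lemma sum_nonempty_cover_le (k : ℕ) {t l : ℝ} (ht0 : 0 ≤ t) (ht1 : t ≤ 1) (hl : 0 ≤ l) :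
    ∑ S ∈ (incomparablePairs k).powerset.erase ∅, t ^ (cover S).card * (1 + (cover S).card * l) ≤
      (2 ^ (incomparablePairs k).card * (1 + k ^ 2)) * (t ^ 2 * (1 + l)) := by
  have hterm : ∀ S ∈ (incomparablePairs k).powerset.erase ∅,
      t ^ (cover S).card * (1 + (cover S).card * l) ≤ (1 + k ^ 2) * (t ^ 2 * (1 + l)) := by
    intro S hS
    rw [Finset.mem_erase, Finset.mem_powerset] at hS
    have h1 : t ^ (cover S).card ≤ t ^ 2 :=
      pow_le_pow_of_le_one ht0 ht1 (two_le_card_cover hS.2 hS.1)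
    have h2 : ((cover S).card : ℝ) ≤ k ^ 2 := by exact_mod_cast card_cover_le S
    have h3 : 1 + ((cover S).card : ℝ) * l ≤ (1 + k ^ 2) * (1 + l) := by
      have := mul_le_mul_of_nonneg_right h2 hl
      nlinarith [sq_nonneg (k : ℝ)]
    calc t ^ (cover S).card * (1 + (cover S).card * l) ≤ t ^ 2 * ((1 + k ^ 2) * (1 + l)) := by
          gcongr
      _ = _ := by ring
  refine (Finset.sum_le_card_nsmul _ _ _ hterm).trans ?_
  rw [nsmul_eq_mul, mul_assoc]
  have hcard : (((incomparablePairs k).powerset.erase ∅).card : ℝ) ≤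
      2 ^ (incomparablePairs k).card := by
    exact_mod_cast (Finset.card_erase_le).trans_eq (Finset.card_powerset _)
  gcongr

lemma sum_cover_le (k : ℕ) {t l : ℝ} (ht0 : 0 ≤ t) (ht1 : t ≤ 1) (hl : 0 ≤ l) :
    ∑ S ∈ (incomparablePairs k).powerset, t ^ (cover S).card * (1 + (cover S).card * l) ≤
      1 + (2 ^ (incomparablePairs k).card * (1 + k ^ 2)) * (t ^ 2 * (1 + l)) := by
  rw [← Finset.add_sum_erase _ _ (Finset.empty_mem_powerset _)]
  refine add_le_add (le_of_eq ?_) (sum_nonempty_cover_le k ht0 ht1 hl)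
  simp [cover]

lemma abs_localWeight_sub_one_le (k : ℕ) {t : ℝ} (ht0 : 0 ≤ t) (ht1 : t ≤ 1) :
    |localWeight k t - 1| ≤ (2 ^ (incomparablePairs k).card * (1 + k ^ 2)) * t ^ 2 := by
  rw [localWeight, ← Finset.add_sum_erase _ _ (Finset.empty_mem_powerset _)]
  have h := sum_nonempty_cover_le k ht0 ht1 le_rfl
  simp only [mul_zero, add_zero, mul_one] at h
  simp only [Finset.card_empty, pow_zero, one_mul, cover, Finset.image_empty, Finset.union_empty,
    add_sub_cancel_left]
  refine (Finset.abs_sum_le_sum_abs _ _).trans (le_trans (Finset.sum_le_sum fun S _ => ?_) h)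
  rw [abs_mul, abs_pow, abs_neg, abs_one, one_pow, one_mul, abs_of_nonneg (pow_nonneg ht0 _)]
  rfl

/-! ### The global expansion over squarefree moduli -/

/-- The modulus attached to a choice, for each prime `p ∈ P`, of a set `s p` of incomparable pairs:
its entry at `v` is the product of the primes `p` for which `v` is covered by `s p`. -/
def modulus {k : ℕ} {P : Finset ℕ} (s : P → Finset ((Fin k × Fin k) × (Fin k × Fin k)))
    (v : Fin k × Fin k) : ℕ :=
  ∏ p : P, if v ∈ cover (s p) then (p : ℕ) else 1

lemma modulus_ne_zero {k : ℕ} {P : Finset ℕ} (hP : ∀ p ∈ P, p.Prime)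
    (s : P → Finset ((Fin k × Fin k) × (Fin k × Fin k))) (v : Fin k × Fin k) :
    modulus s v ≠ 0 :=
  Finset.prod_ne_zero_iff.2 fun p _ => by
    split_ifs
    · exact (hP p p.2).ne_zero
    · exact one_ne_zero

lemma modulus_dvd_iff {k : ℕ} {P : Finset ℕ} (hP : ∀ p ∈ P, p.Prime)
    (s : P → Finset ((Fin k × Fin k) × (Fin k × Fin k))) (x : Fin k × Fin k → ℕ) :
    (∀ p : P, ∀ v ∈ cover (s p), (p : ℕ) ∣ x v) ↔ ∀ v, modulus s v ∣ x v := by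
  constructor
  · intro h v
    refine Fintype.prod_dvd_of_isRelPrime (fun p q hpq => ?_) fun p => ?_
    · have hcop : Nat.Coprime p q :=
        (Nat.coprime_primes (hP p p.2) (hP q q.2)).2 fun h => hpq (Subtype.ext h)
      simp only [Function.onFun]
      split_ifs
      · exact Nat.coprime_iff_isRelPrime.1 hcop
      · exact isRelPrime_one_right
      · exact isRelPrime_one_left
      · exact isRelPrime_one_left
    · split_ifs with hv
      · exact h p v hv
      · exact one_dvd _
  · intro h p v hv
    refine dvd_trans ?_ (h v)
    have := Finset.dvd_prod_of_mem (fun p : P => if v ∈ cover (s p) then (p : ℕ) else 1)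
      (Finset.mem_univ p)
    rwa [if_pos hv] at this

lemma prod_modulus {k : ℕ} {P : Finset ℕ}
    (s : P → Finset ((Fin k × Fin k) × (Fin k × Fin k))) :
    ∏ v, modulus s v = ∏ p : P, (p : ℕ) ^ (cover (s p)).card := by
  simp only [modulus]
  rw [Finset.prod_comm]
  refine Finset.prod_congr rfl fun p _ => ?_
  rw [Finset.prod_ite_mem, Finset.univ_inter, Finset.prod_const]

lemma sum_log_modulus {k : ℕ} {P : Finset ℕ} (hP : ∀ p ∈ P, p.Prime)
    (s : P → Finset ((Fin k × Fin k) × (Fin k × Fin k))) :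
    ∑ v, Real.log (modulus s v) = ∑ p : P, (cover (s p)).card * Real.log p := by
  rw [← Real.log_prod fun v _ => Nat.cast_ne_zero.2 (modulus_ne_zero hP s v), ← Nat.cast_prod,
    prod_modulus, Nat.cast_prod, Real.log_prod fun (p : P) _ => Nat.cast_ne_zero.2
      (pow_ne_zero _ (hP p p.2).ne_zero)]
  refine Finset.sum_congr rfl fun p _ => ?_
  rw [Nat.cast_pow, Real.log_pow]

lemma isStaircaseArray_iff {k N : ℕ} {P : Finset ℕ} (hP : ∀ p, p ∈ P ↔ p.Prime ∧ p ≤ N)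
    {x : Fin k × Fin k → ℕ} (hx : x ∈ boundedArrays k N) :
    IsStaircaseArray x ↔ ∀ p : P, IsStaircase fun v => (p : ℕ) ∣ x v := by
  refine ⟨fun h p => h p ((hP p).1 p.2).1, fun h p hp => ?_⟩
  by_cases hpN : p ≤ N
  · exact h ⟨p, (hP p).2 ⟨hp, hpN⟩⟩
  · -- A prime exceeding `N` divides none of the entries.
    intro i i' j j' _ _ ⟨h1, _⟩
    have hmem := (Fintype.mem_piFinset.1 (Finset.mem_filter.1 hx).1) (i, j)
    rw [Finset.mem_Icc] at hmem
    exact hpN ((Nat.le_of_dvd hmem.1 h1).trans hmem.2)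

open Classical in
lemma staircaseArray_indicator {k N : ℕ} {P : Finset ℕ} (hP : ∀ p, p ∈ P ↔ p.Prime ∧ p ≤ N)
    {x : Fin k × Fin k → ℕ} (hx : x ∈ boundedArrays k N) :
    (if IsStaircaseArray x then (1 : ℝ) else 0) =
      ∑ s ∈ Fintype.piFinset fun _ : P => (incomparablePairs k).powerset,
        (∏ p, (-1 : ℝ) ^ (s p).card) * if ∀ v, modulus s v ∣ x v then (1 : ℝ) else 0 := by
  have h1 : (if IsStaircaseArray x then (1 : ℝ) else 0) =
      ∏ p : P, if IsStaircase (fun v => (p : ℕ) ∣ x v) then (1 : ℝ) else 0 := by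
    rw [Fintype.prod_ite_zero, Finset.prod_const_one]
    simp only [isStaircaseArray_iff hP hx]
  rw [h1]
  simp_rw [staircase_indicator]
  rw [Finset.prod_univ_sum]
  refine Finset.sum_congr rfl fun s _ => ?_
  rw [Finset.prod_mul_distrib]
  congr 1
  have hiff := modulus_dvd_iff (fun p hp => ((hP p).1 hp).1) s x
  by_cases h : ∀ v, modulus s v ∣ x v
  · rw [if_pos h]
    exact Finset.prod_eq_one fun p _ => if_pos (hiff.2 h p)
  · rw [if_neg h]
    obtain ⟨p, hp⟩ := not_forall.1 (mt hiff.1 h)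
    exact Finset.prod_eq_zero (Finset.mem_univ p) (if_neg hp)

lemma pseudomoment_expansion {k N : ℕ} {P : Finset ℕ} (hP : ∀ p, p ∈ P ↔ p.Prime ∧ p ≤ N) :
    pseudomoment k N = ∑ s ∈ Fintype.piFinset fun _ : P => (incomparablePairs k).powerset,
      (∏ p, (-1 : ℝ) ^ (s p).card * (1 / (p : ℝ)) ^ (cover (s p)).card) *
        multiplesSum k N (modulus s) := by
  classical
  have hP' : ∀ p ∈ P, p.Prime := fun p hp => ((hP p).1 hp).1
  rw [pseudomoment_eq_sum_arrays]
  have h1 : ∀ x ∈ boundedArrays k N,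
      (if IsStaircaseArray x then 1 / ((∏ v, x v : ℕ) : ℝ) else 0) =
        ∑ s ∈ Fintype.piFinset fun _ : P => (incomparablePairs k).powerset,
          (∏ p, (-1 : ℝ) ^ (s p).card) *
            if ∀ v, modulus s v ∣ x v then 1 / ((∏ v, x v : ℕ) : ℝ) else 0 := by
    intro x hx
    have h := congrArg (· * (1 / ((∏ v, x v : ℕ) : ℝ))) (staircaseArray_indicator hP hx)
    simp only [ite_mul, one_mul, zero_mul, Finset.sum_mul, mul_assoc] at h
    exact h
  rw [Finset.sum_congr rfl h1, Finset.sum_comm]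
  refine Finset.sum_congr rfl fun s _ => ?_
  rw [← Finset.mul_sum, ← Finset.sum_filter, Finset.prod_mul_distrib, mul_assoc, multiplesSum]
  congr 1
  rw [Finset.mul_sum]
  refine Finset.sum_congr rfl fun x hx => ?_
  have hprod : ∏ p : P, (1 / (p : ℝ)) ^ (cover (s p)).card = ∏ v, 1 / (modulus s v : ℝ) := by
    simp only [one_div, inv_pow, Finset.prod_inv_distrib]
    rw [← Nat.cast_prod, prod_modulus, Nat.cast_prod]
    simp only [Nat.cast_pow]
  rw [hprod, ← Finset.prod_mul_distrib, Nat.cast_prod, one_div, ← Finset.prod_inv_distrib]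
  refine Finset.prod_congr rfl fun v _ => ?_
  have hne : (modulus s v : ℝ) ≠ 0 := Nat.cast_ne_zero.2 (modulus_ne_zero hP' s v)
  rw [Nat.cast_div ((Finset.mem_filter.1 hx).2 v) hne, one_div_div, one_div,
    div_eq_mul_inv, inv_mul_cancel_left₀ hne]

lemma one_add_sum_le_prod_one_add {ι : Type*} (s : Finset ι) {f : ι → ℝ} (hf : ∀ i, 0 ≤ f i) :
    1 + ∑ i ∈ s, f i ≤ ∏ i ∈ s, (1 + f i) := by
  classical
  induction s using Finset.induction_on with
  | empty => simp
  | insert a s ha ih =>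
    rw [Finset.sum_insert ha, Finset.prod_insert ha]
    have h1 : 0 ≤ ∑ i ∈ s, f i := Finset.sum_nonneg fun i _ => hf i
    nlinarith [hf a, mul_nonneg (hf a) h1]

/-- The pseudomoment is the product of the local factors over `p ≤ X` times the volume of the
dilated polytope, up to an error one logarithm smaller whose constant is again an Euler product:
the logarithmic loss `1 + ∑ log e` for the modulus `e` is dominated by a product over primes. -/
lemma exists_pseudomoment_bound (k : ℕ) : ∃ K : ℝ, 0 ≤ K ∧ ∀ X : ℝ, 0 < X → 1 ≤ Real.log X →
    ∀ P : Finset ℕ, (∀ p, p ∈ P ↔ p.Prime ∧ p ≤ ⌊X⌋₊) →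
      |pseudomoment k ⌊X⌋₊ -
          (∏ p ∈ P, localWeight k (1 / (p : ℝ))) * geometricFactor k * Real.log X ^ (k ^ 2)| ≤
        K * (∏ p ∈ P, (1 + (2 ^ (incomparablePairs k).card * (1 + k ^ 2)) *
          ((1 / (p : ℝ)) ^ 2 * (1 + Real.log p)))) * Real.log X ^ (k ^ 2 - 1) := by
  obtain ⟨K, hK, hbound⟩ := exists_multiplesSum_bound k
  refine ⟨K, hK, fun X hX0 hX P hP => ?_⟩
  have hP' : ∀ p ∈ P, p.Prime := fun p hp => ((hP p).1 hp).1
  have hL : 0 ≤ Real.log X ^ (k ^ 2 - 1) := by positivity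
  have hlog : ∀ p : ℕ, 0 ≤ Real.log p := fun p => Real.log_natCast_nonneg p
  rw [pseudomoment_expansion hP, ← Finset.prod_coe_sort P]
  simp only [localWeight]
  rw [Finset.prod_univ_sum, mul_assoc, Finset.sum_mul, ← Finset.sum_sub_distrib]
  simp only [← mul_sub]
  refine (Finset.abs_sum_le_sum_abs _ _).trans ?_
  have hterm : ∀ s ∈ Fintype.piFinset fun _ : P => (incomparablePairs k).powerset,
      |(∏ p, (-1 : ℝ) ^ (s p).card * (1 / (p : ℝ)) ^ (cover (s p)).card) *
        (multiplesSum k ⌊X⌋₊ (modulus s) - geometricFactor k * Real.log X ^ (k ^ 2))| ≤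
      (K * Real.log X ^ (k ^ 2 - 1)) * ∏ p : P, ((1 / (p : ℝ)) ^ (cover (s p)).card *
        (1 + (cover (s p)).card * Real.log p)) := by
    intro s _
    have h1 : |∏ p : P, (-1 : ℝ) ^ (s p).card * (1 / (p : ℝ)) ^ (cover (s p)).card| =
        ∏ p : P, (1 / (p : ℝ)) ^ (cover (s p)).card := by
      rw [Finset.abs_prod]
      refine Finset.prod_congr rfl fun p _ => ?_
      rw [abs_mul, abs_pow, abs_neg, abs_one, one_pow, one_mul, abs_of_nonneg (by positivity)]
    have h2 : 1 + ∑ v, Real.log (modulus s v) ≤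
        ∏ p : P, (1 + (cover (s p)).card * Real.log p) := by
      rw [sum_log_modulus hP' s]
      exact one_add_sum_le_prod_one_add _ fun p => mul_nonneg (Nat.cast_nonneg _) (hlog _)
    rw [abs_mul, h1, Finset.prod_mul_distrib]
    have h0 : 0 ≤ ∏ p : P, (1 / (p : ℝ)) ^ (cover (s p)).card :=
      Finset.prod_nonneg fun p _ => by positivity
    calc _ ≤ (∏ p : P, (1 / (p : ℝ)) ^ (cover (s p)).card) *
          (K * (1 + ∑ v, Real.log (modulus s v)) * Real.log X ^ (k ^ 2 - 1)) :=
          mul_le_mul_of_nonneg_left (hbound X hX0 hX _ (modulus_ne_zero hP' s)) h0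
      _ ≤ (∏ p : P, (1 / (p : ℝ)) ^ (cover (s p)).card) *
          (K * (∏ p : P, (1 + (cover (s p)).card * Real.log p)) *
            Real.log X ^ (k ^ 2 - 1)) := by gcongr
      _ = _ := by ring
  refine (Finset.sum_le_sum hterm).trans ?_
  rw [← Finset.mul_sum, ← Finset.prod_univ_sum (fun _ => (incomparablePairs k).powerset)
    fun (p : P) S => (1 / (p : ℝ)) ^ (cover S).card * (1 + (cover S).card * Real.log p),
    ← Finset.prod_coe_sort P]
  have hprod : ∏ p : P, ∑ S ∈ (incomparablePairs k).powerset,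
      (1 / (p : ℝ)) ^ (cover S).card * (1 + (cover S).card * Real.log p) ≤
      ∏ p : P, (1 + (2 ^ (incomparablePairs k).card * (1 + k ^ 2)) *
          ((1 / (p : ℝ)) ^ 2 * (1 + Real.log p))) := by
    refine Finset.prod_le_prod (fun p _ => Finset.sum_nonneg fun S _ => ?_) fun p _ => ?_
    · have := hlog p
      positivity
    · refine sum_cover_le k (by positivity) ?_ (hlog p)
      rw [div_le_one (Nat.cast_pos.2 (hP' p p.2).pos)]
      exact_mod_cast (hP' p p.2).one_le
  calc _ ≤ _ := mul_le_mul_of_nonneg_left hprod (mul_nonneg hK hL)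
    _ = _ := by ring

/-! ### Truncating the Euler product -/

lemma prod_one_add_le_exp_tsum {ι : Type*} {w : ι → ℝ} (hw : Summable w) (hw0 : ∀ i, 0 ≤ w i)
    (s : Finset ι) : ∏ i ∈ s, (1 + w i) ≤ Real.exp (∑' i, w i) := by
  calc ∏ i ∈ s, (1 + w i) ≤ ∏ i ∈ s, Real.exp (w i) :=
        Finset.prod_le_prod (fun i _ => by linarith [hw0 i]) fun i _ => by
          linarith [Real.add_one_le_exp (w i)]
    _ = Real.exp (∑ i ∈ s, w i) := (Real.exp_sum s w).symm
    _ ≤ _ := Real.exp_le_exp.2 (hw.sum_le_tsum s fun i _ => hw0 i)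

/-- If the factors `1 + f i` outside `s` satisfy `|f i| ≤ w i / L` with `w` summable, then the
product over `s` differs from the whole product by `O(1 / L)`. -/
lemma abs_tprod_sub_prod_le {ι : Type*} {f w : ι → ℝ} (hw : Summable w) (hfw : ∀ i, |f i| ≤ w i)
    {L : ℝ} (hL : 1 ≤ L) (s : Finset ι) (hs : ∀ i, i ∉ s → L * |f i| ≤ w i) :
    |∏' i, (1 + f i) - ∏ i ∈ s, (1 + f i)| ≤
      Real.exp (∑' i, w i) * ((∑' i, w i) * Real.exp (∑' i, w i)) / L := by
  classical
  have hw0 : ∀ i, 0 ≤ w i := fun i => (abs_nonneg _).trans (hfw i)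
  set W := ∑' i, w i with hW
  have hW0 : 0 ≤ W := tsum_nonneg hw0
  have hL0 : 0 < L := by linarith
  have hf : Summable fun i => ‖f i‖ :=
    Summable.of_nonneg_of_le (fun i => norm_nonneg _) hfw hw
  have hlim : Tendsto (fun t : Finset ι => |∏ i ∈ t, (1 + f i) - ∏ i ∈ s, (1 + f i)|) atTop
      (𝓝 |∏' i, (1 + f i) - ∏ i ∈ s, (1 + f i)|) :=
    ((multipliable_one_add_of_summable hf).hasProd.sub_const _).abs
  refine le_of_tendsto hlim ?_
  filter_upwards [eventually_ge_atTop s] with t hst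
  have hsmall : |∏ i ∈ s, (1 + f i)| ≤ Real.exp W := by
    rw [Finset.abs_prod]
    refine (Finset.prod_le_prod (fun i _ => abs_nonneg _) fun i _ => ?_).trans
      (prod_one_add_le_exp_tsum hw hw0 s)
    exact (abs_add_le _ _).trans (by rw [abs_one]; linarith [hfw i])
  have hsum : ∑ i ∈ t \ s, ‖f i‖ ≤ W / L := by
    rw [le_div_iff₀ hL0, Finset.sum_mul]
    refine (Finset.sum_le_sum fun i hi => ?_).trans (hw.sum_le_tsum (t \ s) fun i _ => hw0 i)
    rw [mul_comm]
    exact hs i (Finset.mem_sdiff.1 hi).2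
  have hexp : ∀ y : ℝ, 0 ≤ y → Real.exp y - 1 ≤ y * Real.exp y := fun y _ => by
    have h := mul_le_mul_of_nonneg_right (Real.one_sub_le_exp_neg y) (Real.exp_pos y).le
    rw [← Real.exp_add, neg_add_cancel, Real.exp_zero] at h
    linarith
  have htail : |∏ i ∈ t \ s, (1 + f i) - 1| ≤ W / L * Real.exp W := by
    refine ((t \ s).norm_prod_one_add_sub_one_le f).trans ?_
    have hWL : W / L ≤ W := div_le_self hW0 hL
    calc Real.exp (∑ i ∈ t \ s, ‖f i‖) - 1 ≤ Real.exp (W / L) - 1 := by gcongr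
      _ ≤ W / L * Real.exp (W / L) := hexp _ (by positivity)
      _ ≤ W / L * Real.exp W := by gcongr
  rw [← Finset.prod_sdiff hst, ← sub_one_mul, abs_mul, mul_comm]
  calc _ ≤ Real.exp W * (W / L * Real.exp W) := by gcongr
    _ = _ := by ring

lemma summable_sq_inv_mul_log :
    Summable fun n : ℕ => (1 / (n : ℝ)) ^ 2 * (1 + Real.log n) := by
  have h : Summable fun n : ℕ => 3 * (1 / (n : ℝ) ^ (3 / 2 : ℝ)) :=
    (Real.summable_one_div_nat_rpow.2 (by norm_num)).mul_left 3
  refine Summable.of_nonneg_of_le (fun n => ?_) (fun n => ?_) h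
  · have := Real.log_natCast_nonneg n
    positivity
  · rcases Nat.eq_zero_or_pos n with rfl | hn
    · simp
    · have hn1 : (1 : ℝ) ≤ n := by exact_mod_cast hn
      have h1 : Real.log n ≤ n ^ (1 / 2 : ℝ) / (1 / 2) :=
        Real.log_natCast_le_rpow_div n (by norm_num)
      have h2 : (1 : ℝ) ≤ (n : ℝ) ^ (1 / 2 : ℝ) := Real.one_le_rpow hn1 (by norm_num)
      have h3 : (n : ℝ) ^ 2 = (n : ℝ) ^ (3 / 2 : ℝ) * (n : ℝ) ^ (1 / 2 : ℝ) := by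
        rw [← Real.rpow_add (by linarith), ← Real.rpow_natCast]
        norm_num
      have h4 : 0 < (n : ℝ) ^ (1 / 2 : ℝ) := by positivity
      have h5 : 0 < (n : ℝ) ^ (3 / 2 : ℝ) := by positivity
      rw [one_div_pow, h3, mul_one_div, div_mul_eq_mul_div, one_mul,
        div_le_div_iff₀ (by positivity) h5]
      nlinarith

/-- The summable majorant, indexed by the primes, of the deviations of the local factors from `1`.
The logarithm lets it control both the error terms of the lattice sums and the tail of the Euler
product. -/
noncomputable def localMajorant (k : ℕ) (p : Nat.Primes) : ℝ :=
  (2 ^ (incomparablePairs k).card * (1 + k ^ 2)) *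
    ((1 / ((p : ℕ) : ℝ)) ^ 2 * (1 + Real.log (p : ℕ)))

lemma summable_localMajorant (k : ℕ) : Summable (localMajorant k) :=
  (summable_sq_inv_mul_log.comp_injective Nat.Primes.coe_nat_injective).mul_left _

/-- Used with `L = 1`, and with `L = log X` for the primes `p > X`. -/
lemma log_mul_abs_localFactor_sub_one_le (k : ℕ) (p : Nat.Primes) {L : ℝ}
    (hL : L ≤ 1 + Real.log (p : ℕ)) : L * |localFactor k p - 1| ≤ localMajorant k p := by
  have hp1 : (1 : ℝ) ≤ (p : ℕ) := by exact_mod_cast p.2.one_le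
  have h := abs_localWeight_sub_one_le k (t := 1 / ((p : ℕ) : ℝ)) (by positivity)
    (by rw [div_le_one (by linarith)]; exact hp1)
  have hlog : 0 ≤ 1 + Real.log (p : ℕ) := by linarith [Real.log_nonneg hp1]
  rw [localFactor_eq k p.2, localMajorant, ← mul_assoc, mul_comm _ (1 + Real.log (p : ℕ))]
  exact (mul_le_mul_of_nonneg_right hL (abs_nonneg _)).trans (mul_le_mul_of_nonneg_left h hlog)

lemma abs_localFactor_sub_one_le (k : ℕ) (p : Nat.Primes) :
    |localFactor k p - 1| ≤ localMajorant k p := by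
  have := log_mul_abs_localFactor_sub_one_le k p (L := 1)
    (by linarith [Real.log_natCast_nonneg (p : ℕ)])
  rwa [one_mul] at this

lemma multipliable_localFactor (k : ℕ) : Multipliable fun p : Nat.Primes => localFactor k p := by
  have h : Summable fun p : Nat.Primes => ‖localFactor k p - 1‖ :=
    Summable.of_nonneg_of_le (fun _ => norm_nonneg _) (abs_localFactor_sub_one_le k)
      (summable_localMajorant k)
  simpa using multipliable_one_add_of_summable h

theorem pseudomoment_sub_isBigO {k : ℕ} (hk : 1 ≤ k) :
    (fun X : ℝ => pseudomoment k ⌊X⌋₊ -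
      arithmeticFactor k * geometricFactor k * Real.log X ^ (k ^ 2))
      =O[atTop] fun X : ℝ => Real.log X ^ (k ^ 2 - 1) := by
  obtain ⟨K, hK, hbound⟩ := exists_pseudomoment_bound k
  have hγ := geometricFactor_nonneg k
  have hw := summable_localMajorant k
  have hw0 : ∀ p, 0 ≤ localMajorant k p := fun p =>
    (abs_nonneg _).trans (abs_localFactor_sub_one_le k p)
  set W := ∑' p, localMajorant k p with hW
  refine IsBigO.of_bound
    (K * Real.exp W + Real.exp W * (W * Real.exp W) * geometricFactor k) ?_
  filter_upwards [eventually_ge_atTop (Real.exp 1)] with X hX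
  have hX0 : 0 < X := (Real.exp_pos 1).trans_le hX
  have hL : 1 ≤ Real.log X := (Real.le_log_iff_exp_le hX0).2 hX
  have hL0 : 0 < Real.log X := by linarith
  set P : Finset ℕ := {p ∈ Finset.range (⌊X⌋₊ + 1) | p.Prime} with hPdef
  have hP : ∀ p, p ∈ P ↔ p.Prime ∧ p ≤ ⌊X⌋₊ := fun p => by
    rw [hPdef, Finset.mem_filter, Finset.mem_range, Nat.lt_succ_iff, and_comm]
  set s : Finset Nat.Primes := P.subtype Nat.Prime with hsdef
  have hPs : ∀ f : ℕ → ℝ, ∏ p ∈ P, f p = ∏ p ∈ s, f p := fun f =>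
    (Finset.prod_subtype_of_mem f fun p hp => ((hP p).1 hp).1).symm
  have h1 := hbound X hX0 hL P hP
  rw [hPs fun p => localWeight k (1 / (p : ℝ)),
    hPs fun p => 1 + (2 ^ (incomparablePairs k).card * (1 + k ^ 2)) *
      ((1 / (p : ℝ)) ^ 2 * (1 + Real.log p)),
    Finset.prod_congr rfl fun p _ => (localFactor_eq k p.2).symm] at h1
  have h2 : K * (∏ p ∈ s, (1 + localMajorant k p)) * Real.log X ^ (k ^ 2 - 1) ≤
      K * Real.exp W * Real.log X ^ (k ^ 2 - 1) := by
    have := prod_one_add_le_exp_tsum hw hw0 s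
    gcongr
  have h3 : |arithmeticFactor k - ∏ p ∈ s, localFactor k p| ≤
      Real.exp W * (W * Real.exp W) / Real.log X := by
    have h := abs_tprod_sub_prod_le hw (abs_localFactor_sub_one_le k) hL s fun p hp => by
      refine log_mul_abs_localFactor_sub_one_le k p ?_
      have hlt : ⌊X⌋₊ < p := by
        by_contra! hle
        exact hp (Finset.mem_subtype.2 ((hP p).2 ⟨p.2, hle⟩))
      have := Real.log_le_log hX0 ((Nat.floor_lt hX0.le).1 hlt).le
      linarith
    simpa [arithmeticFactor] using h
  have h4 : Real.exp W * (W * Real.exp W) / Real.log X *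
      (geometricFactor k * Real.log X ^ (k ^ 2)) =
      Real.exp W * (W * Real.exp W) * geometricFactor k * Real.log X ^ (k ^ 2 - 1) := by
    rw [← mul_pow_sub_one (pow_ne_zero 2 (Nat.one_le_iff_ne_zero.1 hk)) (Real.log X)]
    field_simp
  have hsplit : pseudomoment k ⌊X⌋₊ -
      arithmeticFactor k * geometricFactor k * Real.log X ^ (k ^ 2) =
      (pseudomoment k ⌊X⌋₊ -
        (∏ p ∈ s, localFactor k p) * geometricFactor k * Real.log X ^ (k ^ 2)) -
      (arithmeticFactor k - ∏ p ∈ s, localFactor k p) *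
        (geometricFactor k * Real.log X ^ (k ^ 2)) := by ring
  rw [Real.norm_eq_abs, Real.norm_eq_abs, abs_of_nonneg (pow_nonneg hL0.le (k ^ 2 - 1)), hsplit,
    add_mul, ← h4]
  refine (abs_sub _ _).trans (add_le_add (h1.trans h2) ?_)
  have hnn : 0 ≤ geometricFactor k * Real.log X ^ (k ^ 2) := by positivity
  rw [abs_mul, abs_of_nonneg hnn]
  exact mul_le_mul_of_nonneg_right h3 hnn

end Pseudomoments

theorem theorem1 (k : ℕ) (hk : 1 ≤ k) :
    (∀ p : Nat.Primes, Summable (fun j : ℕ => Pseudomoments.localTerm k p j)) ∧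
    Multipliable (fun p : Nat.Primes => Pseudomoments.localFactor k p) ∧
    ∃ M : ℝ → ℝ,
      (∀ X : ℝ, Tendsto
        (fun T : ℝ => (1 / T) * ∫ t in (0 : ℝ)..T, ‖Pseudomoments.partialZeta X t‖ ^ (2 * k))
        atTop (𝓝 (M X))) ∧
      (fun X : ℝ => M X -
          Pseudomoments.arithmeticFactor k * Pseudomoments.geometricFactor k *
            Real.log X ^ (k ^ 2))
        =O[atTop] (fun X : ℝ => Real.log X ^ (k ^ 2 - 1)) := by
  exact ⟨fun p => (Pseudomoments.hasSum_localTerm k p.2).summable,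
    Pseudomoments.multipliable_localFactor k,
    fun X => Pseudomoments.pseudomoment k ⌊X⌋₊, Pseudomoments.tendsto_mean_partialZeta k,
    Pseudomoments.pseudomoment_sub_isBigO hk⟩
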